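/- A germ means a germ at $0\in\mathbb R$. Let $C^\omega_0$ be the set of germs of real-analytic functions defined in some neighborhood of $0\in\mathbb R$. Let $g$ be a real-analytic function on an interval $]-\varepsilon,\varepsilon[$, $\varepsilon>0$, with $g(0)=0$ and $g'(0)>0$. One says that $0\in\mathbb R^2$ is an isochronous center of $x''+g(x)=0$ if, for the planar system $\dot x=y,\ \dot y=-g(x)$ on $]-\varepsilon,\varepsilon[\times\mathbb R$, all orbits other than the origin itself through points of some neighborhood of the origin are closed, surround the origin, and have the same minimal period. Let $\mathrm{Isochr}(0,\omega)$ be the set of germs of all such functions $g$ for which $0$ is an isochronous center. For a function $g$ as above, put $G(x)=\int_0^x g(u)\,du$. For $f$ representing a germ in $C_0^\omega$, the Chouikha equation is $$\frac{d}{dx}\left[\frac{G(x)}{g(x)^2}\right]=f(G(x))$$ for all $x$ in some neighborhood of $0$, where the quotient $G/g^2$ is extended continuously to $x=0$; whether it holds depends only on the germs of $f$ and $g$. **Theorem 4.1.** For every $f\in C^\omega_0$ and every real $\lambda>0$ there is exactly one germ of a real-analytic function $g$ with $g(0)=0$ and $g'(0)=\lambda^2$ that solves the Chouikha equation. This germ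 belongs to $\mathrm{Isochr}(0,\omega)$, and the map that sends $(f,\lambda)$ to this germ is a bijection $$C^\omega_0\times\{\lambda\in\mathbb R:\lambda>0\}\longrightarrow \mathrm{Isochr}(0,\omega).$$ -/

import Mathlib

open Filter Topology

namespace ChouikhaIsochronous

/-- A germ at `0 ∈ ℝ` of real functions. -/
abbrev RealGerm : Type := Germ (𝓝 (0 : ℝ)) ℝ

/-- The germs at `0` of real-analytic functions defined in some neighborhood of `0`. -/
def analyticGerms : Set RealGerm :=
  {φ | ∃ f : ℝ → ℝ, AnalyticAt ℝ f 0 ∧ φ = (f : RealGerm)}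

/-- `γ` is a solution, defined for all times, of the planar system `x' = y`, `y' = -g(x)` whose
phase space is the strip `D × ℝ`; the values of `g` outside `D` play no role. -/
def IsSolution (D : Set ℝ) (g : ℝ → ℝ) (γ : ℝ → ℝ × ℝ) : Prop :=
  ∀ t : ℝ, (γ t).1 ∈ D ∧ HasDerivAt γ ((γ t).2, -g (γ t).1) t

/-- The planar set `C` surrounds the origin: the origin is not on `C` and the connected component
of the complement of `C` that contains the origin is bounded. -/
def SurroundsOrigin (C : Set (ℝ × ℝ)) : Prop :=
  (0 : ℝ × ℝ) ∉ C ∧ Bornology.IsBounded (connectedComponentIn Cᶜ (0 : ℝ × ℝ))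

/-- `γ` runs along a closed orbit of the system on `D × ℝ` that surrounds the origin, and `T` is
the period of this orbit, that is, the smallest positive period of `γ`. -/
structure IsClosedOrbit (D : Set ℝ) (g : ℝ → ℝ) (γ : ℝ → ℝ × ℝ) (T : ℝ) : Prop where
  solution : IsSolution D g γ
  period : IsLeast {S : ℝ | 0 < S ∧ Function.Periodic γ S} T
  surrounds : SurroundsOrigin (Set.range γ)

/-- The origin is a center of the system `x' = y`, `y' = -g(x)` on `D × ℝ`: it is a singular point
and every orbit through a point `p ≠ 0` of some neighborhood is closed and surrounds it. -/
def IsCenter (D : Set ℝ) (g : ℝ → ℝ) : Prop :=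
  g 0 = 0 ∧ ∃ U ∈ 𝓝 (0 : ℝ × ℝ), ∀ p ∈ U, p ≠ 0 →
    ∃ (γ : ℝ → ℝ × ℝ) (T : ℝ), γ 0 = p ∧ IsClosedOrbit D g γ T

/-- The origin is an isochronous center: it is a center, and all the closed orbits through the
points `p ≠ 0` of some neighborhood have the same period `T`. -/
def IsIsochronousCenter (D : Set ℝ) (g : ℝ → ℝ) : Prop :=
  IsCenter D g ∧ ∃ T : ℝ, ∃ U ∈ 𝓝 (0 : ℝ × ℝ), ∀ p ∈ U, p ≠ 0 →
    ∃ γ : ℝ → ℝ × ℝ, γ 0 = p ∧ IsClosedOrbit D g γ T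

/-- The germs of isochronous centers at `0` of `x'' + g(x) = 0`: the germs of the real-analytic
functions `g` on some interval `]-ε, ε[` with `g(0) = 0` and `g'(0) > 0` for which the origin is an
isochronous center of the system `x' = y`, `y' = -g(x)` on `]-ε, ε[ × ℝ`. -/
def isochronousGerms : Set RealGerm :=
  {ψ | ∃ (g : ℝ → ℝ) (ε : ℝ), ψ = (g : RealGerm) ∧ 0 < ε ∧
    AnalyticOnNhd ℝ g (Set.Ioo (-ε) ε) ∧ g 0 = 0 ∧ 0 < deriv g 0 ∧
    IsIsochronousCenter (Set.Ioo (-ε) ε) g}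

/-- The potential `G(x) = ∫₀ˣ g(u) du`. -/
noncomputable def potential (g : ℝ → ℝ) (x : ℝ) : ℝ := ∫ u in (0 : ℝ)..x, g u

/-- The Chouikha equation `(G / g²)' = f(G)` in a neighborhood of `0`. At `x = 0` the quotient
`G / g²` has the form `0 / 0`; `Q` is its extension to a full neighborhood of `0` (unique, since
`Q` is continuous at `0`), and the equation is required at `0` too. -/
def SolvesChouikha (f g : ℝ → ℝ) : Prop :=
  ∃ Q : ℝ → ℝ,
    (∀ᶠ x in 𝓝[≠] (0 : ℝ), g x ≠ 0 ∧ Q x = potential g x / g x ^ 2) ∧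
    (∀ᶠ x in 𝓝 (0 : ℝ), HasDerivAt Q (f (potential g x)) x)

/-- `ψ` is the germ of a real-analytic solution `g` of the Chouikha equation given by the
real-analytic germ `φ`, with `g(0) = 0` and `g'(0) = lam ^ 2`. -/
def IsAnalyticSolutionGerm (φ : RealGerm) (lam : ℝ) (ψ : RealGerm) : Prop :=
  ∃ f g : ℝ → ℝ, φ = (f : RealGerm) ∧ ψ = (g : RealGerm) ∧ AnalyticAt ℝ f 0 ∧ AnalyticAt ℝ g 0 ∧
    g 0 = 0 ∧ deriv g 0 = lam ^ 2 ∧ SolvesChouikha f g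

end ChouikhaIsochronous

namespace ChouikhaIsochronous

/-! Near `0` let `u = x * √(2 * G x / x ^ 2)`, so that `G = u ^ 2 / 2`, and let `p = dx/du` as a
function of `u`. Then `g = u / p u` and `g' 0 = 1 / p 0 ^ 2`, so germs of `g` correspond to analytic
germs `p` with `p 0 > 0` (`exists_eventuallyEq_force`).

In this coordinate `G / g ^ 2 = p u ^ 2 / 2`, whose `x`-derivative is `p' u`. The Chouikha equation
therefore reads `p' u = f (u ^ 2 / 2)` (`IsSpeed.solvesChouikha_iff`). With `p 0 = 1 / lam` it is
solved by one integration, and a germ `f` exists exactly when `p'` is even, that is, when `p u + p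
(-u)` is constant.

Isochrony is the same condition. With `u = r sin θ`, `y = r cos θ` the system becomes `dt = p (r sin
θ) dθ`, and the orbit of amplitude `r` has period `∫ s in 0..π, (p (r sin s) + p (-r sin s))`. This
is independent of small `r > 0` if and only if the even part of `p` is constant near `0`
(`eventually_orbitPeriod_eq`, `eventually_add_neg_eq_of_orbitPeriod`). -/

/-! ### Power series at `0` -/

theorem analyticAt_zero_of_hasSum {f : ℝ → ℝ} (c : ℕ → ℝ)
    (h : ∀ᶠ z in 𝓝 (0 : ℝ), HasSum (fun n => c n * z ^ n) (f z)) : AnalyticAt ℝ f 0 := by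
  refine ⟨FormalMultilinearSeries.ofScalars ℝ c, ?_⟩
  rw [hasFPowerSeriesAt_iff]
  filter_upwards [h] with z hz
  simpa [FormalMultilinearSeries.coeff_ofScalars, mul_comm] using hz

theorem exists_hasSum_of_analyticAt_zero {f : ℝ → ℝ} (hf : AnalyticAt ℝ f 0) :
    ∃ (c : ℕ → ℝ) (ρ : ℝ), 0 < ρ ∧ (Summable fun n => |c n| * ρ ^ n) ∧
      ∀ z : ℝ, |z| ≤ ρ → HasSum (fun n => c n * z ^ n) (f z) := by
  obtain ⟨p, hp⟩ := hf
  rw [hasFPowerSeriesAt_iff, Metric.eventually_nhds_iff] at hp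
  obtain ⟨r, hr, h⟩ := hp
  have key : ∀ z : ℝ, |z| ≤ r / 2 → HasSum (fun n => p.coeff n * z ^ n) (f z) := by
    intro z hz
    have := h (y := z) (by simpa using by linarith)
    simpa [mul_comm] using this
  refine ⟨p.coeff, r / 2, by positivity, ?_, key⟩
  have := (key (r / 2) (by rw [abs_of_pos (by positivity)])).summable.abs
  simpa [abs_mul, abs_of_pos (half_pos hr)] using this

theorem analyticAt_zero_integral {f : ℝ → ℝ} (hf : AnalyticAt ℝ f 0) :
    AnalyticAt ℝ (fun x => ∫ u in (0 : ℝ)..x, f u) 0 := by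
  obtain ⟨c, ρ, hρ, hc, h⟩ := exists_hasSum_of_analyticAt_zero hf
  have key : ∀ x : ℝ, |x| ≤ ρ →
      HasSum (fun n => c n / (n + 1) * x ^ (n + 1)) (∫ u in (0 : ℝ)..x, f u) := by
    intro x hx
    have hle : ∀ u ∈ Set.uIoc (0 : ℝ) x, |u| ≤ ρ := by
      intro u hu
      have := Set.abs_sub_left_of_mem_uIcc (Set.uIoc_subset_uIcc hu)
      simp at this
      linarith
    have := intervalIntegral.hasSum_integral_of_dominated_convergence
      (μ := MeasureTheory.volume) (a := 0) (b := x) (F := fun n u => c n * u ^ n) (f := f)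
      (fun n _ => |c n| * ρ ^ n)
      (fun n => by fun_prop)
      (fun n => .of_forall fun u hu => by
        rw [Real.norm_eq_abs, abs_mul, abs_pow]
        gcongr
        exact hle u hu)
      (.of_forall fun u hu => hc) (by simp) (.of_forall fun u hu => h u (hle u hu))
    refine this.congr_fun ?_
    intro n
    simp [integral_pow]
    ring
  refine analyticAt_zero_of_hasSum (fun n => if n = 0 then 0 else c (n - 1) / n) ?_
  filter_upwards [Metric.closedBall_mem_nhds (0 : ℝ) hρ] with x hx
  have := key x (by simpa using hx)
  rw [← hasSum_nat_add_iff' 1]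
  simpa using this

/-- Averaging the series at `u` and `-u` removes the odd terms. The factor `2 ^ n` in the new
coefficients compensates for `w = u ^ 2 / 2`. -/
theorem exists_analyticAt_comp_sq {F : ℝ → ℝ} (hF : AnalyticAt ℝ F 0)
    (heven : ∀ᶠ u in 𝓝 (0 : ℝ), F (-u) = F u) :
    ∃ f : ℝ → ℝ, AnalyticAt ℝ f 0 ∧ ∀ᶠ u in 𝓝 (0 : ℝ), F u = f (u ^ 2 / 2) := by
  obtain ⟨c, ρ, hρ, hc, h⟩ := exists_hasSum_of_analyticAt_zero hF
  have hinj : Function.Injective fun n : ℕ => 2 * n := fun a b hab => by simpa using hab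
  have hsum : ∀ w : ℝ, |w| ≤ ρ ^ 2 / 2 → Summable fun n => c (2 * n) * 2 ^ n * w ^ n := by
    intro w hw
    refine Summable.of_norm_bounded (hc.comp_injective hinj) fun n => ?_
    simp only [Real.norm_eq_abs, abs_mul, abs_pow, Function.comp, Nat.abs_ofNat, mul_assoc]
    rw [← mul_pow, pow_mul]
    gcongr
    linarith
  refine ⟨fun w => ∑' n, c (2 * n) * 2 ^ n * w ^ n, ?_, ?_⟩
  · refine analyticAt_zero_of_hasSum (fun n => c (2 * n) * 2 ^ n) ?_
    filter_upwards [Metric.closedBall_mem_nhds (0 : ℝ) (show 0 < ρ ^ 2 / 2 by positivity)] with w hw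
    exact (hsum w (by simpa using hw)).hasSum
  · filter_upwards [heven, Metric.closedBall_mem_nhds (0 : ℝ) hρ] with u hu hu'
    have hu' : |u| ≤ ρ := by simpa using hu'
    have h1 := ((h u hu').add (h (-u) (by simpa using hu'))).div_const 2
    have h2 : HasSum (fun n => c (2 * n) * u ^ (2 * n)) (F u) := by
      rw [hu, add_self_div_two] at h1
      rw [← Function.Injective.hasSum_iff hinj] at h1
      · refine h1.congr_fun ?_
        intro n
        simp [pow_mul]
      · intro n hn
        have : Odd n := by
          rw [← Nat.not_even_iff_odd]
          rintro ⟨m, rfl⟩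
          exact hn ⟨m, by simp; ring⟩
        simp [this.neg_pow]
    rw [← h2.tsum_eq]
    congr 1 with n
    rw [mul_assoc, ← mul_pow, pow_mul]
    congr 2
    ring

theorem _root_.AnalyticAt.sqrt_of_pos {f : ℝ → ℝ} {x : ℝ} (hf : AnalyticAt ℝ f x) (h : 0 < f x) :
    AnalyticAt ℝ (fun y => √(f y)) x :=
  (Real.contDiffAt_sqrt h.ne').analyticAt.comp hf

theorem _root_.AnalyticAt.dslope_self {f : ℝ → ℝ} {x : ℝ} (hf : AnalyticAt ℝ f x) :
    AnalyticAt ℝ (dslope f x) x := by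
  obtain ⟨p, hp⟩ := hf
  exact hp.has_fpower_series_dslope_fslope.analyticAt

/-! ### The coordinate `u` attached to a speed `p` -/

/-- A continuous function on the line that is bounded below by a positive constant. -/
structure IsSpeed (p : ℝ → ℝ) : Prop where
  continuous : Continuous p
  bound : ∃ m > 0, ∀ u, m ≤ p u

/-- The primitive of `p` that vanishes at `0`. -/
noncomputable def primitive (p : ℝ → ℝ) (u : ℝ) : ℝ := ∫ s in (0 : ℝ)..u, p s

/-- The inverse function of `primitive p`. -/
noncomputable def coord (p : ℝ → ℝ) : ℝ → ℝ := Function.invFun (primitive p)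

/-- The function `g` whose potential is `coord p x ^ 2 / 2`. -/
noncomputable def force (p : ℝ → ℝ) (x : ℝ) : ℝ := coord p x / p (coord p x)

@[simp] theorem primitive_zero (p : ℝ → ℝ) : primitive p 0 = 0 := by simp [primitive]

namespace IsSpeed

variable {p : ℝ → ℝ} (hp : IsSpeed p)
include hp

theorem pos (u : ℝ) : 0 < p u := by
  obtain ⟨m, hm, h⟩ := hp.bound
  exact hm.trans_le (h u)

theorem hasDerivAt_primitive (u : ℝ) : HasDerivAt (primitive p) (p u) u :=
  intervalIntegral.integral_hasDerivAt_right (hp.continuous.intervalIntegrable _ _)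
    (hp.continuous.stronglyMeasurableAtFilter _ _) hp.continuous.continuousAt

theorem continuous_primitive : Continuous (primitive p) :=
  continuous_iff_continuousAt.2 fun u => (hp.hasDerivAt_primitive u).continuousAt

theorem strictMono_primitive : StrictMono (primitive p) :=
  strictMono_of_hasDerivAt_pos hp.hasDerivAt_primitive hp.pos

theorem surjective_primitive : Function.Surjective (primitive p) := by
  obtain ⟨m, hm, h⟩ := hp.bound
  -- The positive lower bound makes the primitive grow at least linearly in both directions.
  have hmono : Monotone fun u => primitive p u - m * u := by
    refine monotone_of_hasDerivAt_nonneg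
      (fun u => (hp.hasDerivAt_primitive u).sub ((hasDerivAt_id u).const_mul m)) fun u => ?_
    simpa using h u
  refine hp.continuous_primitive.surjective ?_ ?_
  · refine tendsto_atTop_mono' _ ?_ (tendsto_id.const_mul_atTop hm)
    filter_upwards [eventually_ge_atTop 0] with u hu
    simpa using hmono hu
  · refine tendsto_atBot_mono' _ ?_ (tendsto_id.const_mul_atBot hm)
    filter_upwards [eventually_le_atBot 0] with u hu
    simpa using hmono hu

theorem primitive_coord (x : ℝ) : primitive p (coord p x) = x :=
  Function.rightInverse_invFun hp.surjective_primitive x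

theorem coord_primitive (u : ℝ) : coord p (primitive p u) = u :=
  Function.leftInverse_invFun hp.strictMono_primitive.injective u

theorem strictMono_coord : StrictMono (coord p) := fun x y hxy => by
  rw [← hp.strictMono_primitive.lt_iff_lt, hp.primitive_coord, hp.primitive_coord]
  exact hxy

theorem coord_zero : coord p 0 = 0 := by
  simpa using hp.coord_primitive 0

theorem continuous_coord : Continuous (coord p) :=
  hp.strictMono_coord.monotone.continuous_of_surjective fun u => ⟨_, hp.coord_primitive u⟩

theorem hasDerivAt_coord (x : ℝ) : HasDerivAt (coord p) (p (coord p x))⁻¹ x :=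
  (hp.hasDerivAt_primitive _).of_local_left_inverse hp.continuous_coord.continuousAt
    (hp.pos _).ne' (.of_forall hp.primitive_coord)

theorem coord_eq_zero {x : ℝ} : coord p x = 0 ↔ x = 0 := by
  rw [← hp.coord_zero, hp.strictMono_coord.injective.eq_iff, hp.coord_zero]

theorem tendsto_coord : Tendsto (coord p) (𝓝 0) (𝓝 0) := by
  simpa [hp.coord_zero] using hp.continuous_coord.tendsto 0

theorem tendsto_primitive : Tendsto (primitive p) (𝓝 0) (𝓝 0) := by
  simpa using hp.continuous_primitive.tendsto 0

theorem continuous_force : Continuous (force p) :=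
  hp.continuous_coord.div (hp.continuous.comp hp.continuous_coord) fun _ => (hp.pos _).ne'

theorem force_zero : force p 0 = 0 := by simp [force, hp.coord_zero]

theorem force_eq_zero {x : ℝ} : force p x = 0 ↔ x = 0 := by
  simp [force, (hp.pos _).ne', hp.coord_eq_zero]

theorem force_primitive (u : ℝ) : force p (primitive p u) = u / p u := by
  simp [force, hp.coord_primitive]

theorem hasDerivAt_coord_sq (x : ℝ) :
    HasDerivAt (fun x => coord p x ^ 2 / 2) (force p x) x := by
  refine (((hp.hasDerivAt_coord x).pow 2).div_const 2).congr_deriv ?_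
  simp [force]
  ring

theorem potential_force (x : ℝ) : potential (force p) x = coord p x ^ 2 / 2 := by
  rw [potential, intervalIntegral.integral_eq_sub_of_hasDerivAt
    (fun u _ => hp.hasDerivAt_coord_sq u) (hp.continuous_force.intervalIntegrable _ _)]
  simp [hp.coord_zero]

theorem analyticAt_coord (ha : AnalyticAt ℝ p 0) : AnalyticAt ℝ (coord p) 0 := by
  have h : AnalyticAt ℝ (primitive p) 0 := analyticAt_zero_integral ha
  have hd : deriv (primitive p) 0 ≠ 0 := by
    rw [(hp.hasDerivAt_primitive 0).deriv]
    exact (hp.pos 0).ne'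
  have h1 := h.analyticAt_localInverse hd
  rw [primitive_zero] at h1
  refine h1.congr ?_
  have := h.hasStrictDerivAt.eventually_right_inverse hd
  rw [primitive_zero] at this
  filter_upwards [this] with y hy
  conv_rhs => rw [← hy]
  exact (hp.coord_primitive _).symm

theorem analyticAt_force (ha : AnalyticAt ℝ p 0) : AnalyticAt ℝ (force p) 0 := by
  have h := hp.analyticAt_coord ha
  refine h.div (AnalyticAt.comp (by rwa [hp.coord_zero]) h) (hp.pos _).ne'

theorem deriv_force_zero (ha : AnalyticAt ℝ p 0) : deriv (force p) 0 = (p 0 ^ 2)⁻¹ := by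
  have h := hp.hasDerivAt_coord 0
  have h2 : HasDerivAt p (deriv p 0) (coord p 0) := by
    rw [hp.coord_zero]
    exact ha.differentiableAt.hasDerivAt
  have := (h.div (h2.comp 0 h) (hp.pos _).ne').deriv
  refine this.trans ?_
  have := (hp.pos 0).ne'
  simp [hp.coord_zero]
  field_simp

end IsSpeed

/-! ### Germs and the normal form of `g` -/

theorem primitive_congr {p q : ℝ → ℝ} (h : p =ᶠ[𝓝 0] q) : primitive p =ᶠ[𝓝 0] primitive q := by
  obtain ⟨ρ, hρ, h⟩ := Metric.eventually_nhds_iff.1 h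
  refine Metric.eventually_nhds_iff.2 ⟨ρ, hρ, fun x hx => intervalIntegral.integral_congr ?_⟩
  intro u hu
  have := Set.abs_sub_left_of_mem_uIcc hu
  refine h ?_
  simp at this hx ⊢
  linarith

theorem force_congr {p q : ℝ → ℝ} (hp : IsSpeed p) (hq : IsSpeed q) (h : p =ᶠ[𝓝 0] q) :
    force p =ᶠ[𝓝 0] force q := by
  filter_upwards [hp.tendsto_coord.eventually (primitive_congr h),
    hp.tendsto_coord.eventually h] with x hx hx'
  have : coord p x = coord q x := by
    rw [hp.primitive_coord] at hx
    rw [hx, hq.coord_primitive, ← hx]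
  rw [force, force, hx', this]

theorem potential_congr {g k : ℝ → ℝ} (h : g =ᶠ[𝓝 0] k) : potential g =ᶠ[𝓝 0] potential k :=
  primitive_congr h

/-- Freezing `p` outside a small interval where it exceeds `p 0 / 2` keeps its germ, while the
inverse coordinate and the orbits become globally defined. -/
theorem exists_isSpeed_eventuallyEq {p : ℝ → ℝ} (hp : ContinuousAt p 0)
    (hc : ∀ᶠ u in 𝓝 (0 : ℝ), ContinuousAt p u) (h0 : 0 < p 0) :
    ∃ q, IsSpeed q ∧ q =ᶠ[𝓝 0] p := by
  have h1 := hp.eventually (lt_mem_nhds (half_lt_self h0))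
  obtain ⟨ρ, hρ, h⟩ := Metric.eventually_nhds_iff.1 (hc.and h1)
  have hab : -(ρ / 2) ≤ ρ / 2 := by linarith
  have hmem : ∀ u : Set.Icc (-(ρ / 2)) (ρ / 2), dist (u : ℝ) 0 < ρ := by
    rintro ⟨u, hu⟩
    have := abs_le.2 hu
    simp
    linarith
  refine ⟨Set.IccExtend hab fun u => p u, ⟨?_, p 0 / 2, by positivity, fun u => ?_⟩, ?_⟩
  · refine Continuous.Icc_extend' ?_
    refine continuous_iff_continuousAt.2 fun u => ?_
    exact (h (hmem u)).1.comp continuous_subtype_val.continuousAt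
  · exact (h (hmem _)).2.le
  · filter_upwards [Icc_mem_nhds (show -(ρ / 2) < 0 by linarith) (show 0 < ρ / 2 by linarith)]
      with u hu
    exact Set.IccExtend_of_mem hab _ hu

theorem eventually_hasDerivAt_primitive {f : ℝ → ℝ} (hf : AnalyticAt ℝ f 0) :
    ∀ᶠ x in 𝓝 (0 : ℝ), HasDerivAt (primitive f) (f x) x := by
  obtain ⟨ρ, hρ, h⟩ := Metric.eventually_nhds_iff_ball.1 hf.eventually_analyticAt
  filter_upwards [Metric.ball_mem_nhds 0 hρ] with x hx
  have hc : ContinuousOn f (Metric.ball 0 ρ) := fun y hy =>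
    (h y hy).continuousAt.continuousWithinAt
  refine intervalIntegral.integral_hasDerivAt_right ?_ ?_ (h x hx).continuousAt
  · refine ContinuousOn.intervalIntegrable (hc.mono ?_)
    rw [← segment_eq_uIcc]
    exact (convex_ball _ _).segment_subset (by simpa) hx
  · exact hc.stronglyMeasurableAtFilter Metric.isOpen_ball x hx

/-- Every analytic `g` with `g 0 = 0` and `g' 0 > 0` is, near `0`, of the form `force p`. -/
theorem exists_eventuallyEq_force {g : ℝ → ℝ} (hg : AnalyticAt ℝ g 0) (h0 : g 0 = 0)
    (h1 : 0 < deriv g 0) :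
    ∃ p, IsSpeed p ∧ AnalyticAt ℝ p 0 ∧ g =ᶠ[𝓝 0] force p := by
  have hG : AnalyticAt ℝ (potential g) 0 := analyticAt_zero_integral hg
  have hGd : ∀ᶠ x in 𝓝 (0 : ℝ), HasDerivAt (potential g) (g x) x :=
    eventually_hasDerivAt_primitive hg
  -- Two divided differences remove the double zero of the potential: `G x = x ^ 2 * k x` with `k`
  -- analytic and `k 0 = g' 0 / 2 > 0`.
  set a := dslope (potential g) 0 with ha_def
  have ha : AnalyticAt ℝ a 0 := hG.dslope_self
  set k := dslope a 0 with hk_def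
  have hk : AnalyticAt ℝ k 0 := ha.dslope_self
  have hG0 : potential g 0 = 0 := by simp [potential]
  have ha0 : a 0 = 0 := by
    rw [ha_def, dslope_same, hGd.self_of_nhds.deriv, h0]
  have hGk : ∀ x, potential g x = x ^ 2 * k x := by
    intro x
    have e1 := sub_smul_dslope (potential g) 0 x
    have e2 := sub_smul_dslope a 0 x
    simp only [sub_zero, hG0, ha0, smul_eq_mul] at e1 e2
    rw [← e1, ← ha_def, ← e2, ← hk_def]
    ring
  have hgk : ∀ᶠ x in 𝓝 (0 : ℝ), g x = 2 * x * k x + x ^ 2 * deriv k x := by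
    filter_upwards [hGd, hk.eventually_analyticAt] with x hx hx'
    have := ((hasDerivAt_pow 2 x).mul hx'.differentiableAt.hasDerivAt)
    have h2 : potential g = (fun x => x ^ 2) * k := funext hGk
    rw [← h2] at this
    simpa using hx.unique this
  have hk0 : k 0 = deriv g 0 / 2 := by
    have e : deriv g 0 = deriv (fun x => 2 * x * k x + x ^ 2 * deriv k x) 0 :=
      EventuallyEq.deriv_eq hgk
    have hd := (((hasDerivAt_id (0 : ℝ)).const_mul 2).mul hk.differentiableAt.hasDerivAt).add
      ((hasDerivAt_pow 2 (0 : ℝ)).mul hk.deriv.differentiableAt.hasDerivAt)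
    have := hd.deriv
    simp only [id] at this
    rw [e]
    refine (eq_div_iff two_ne_zero).2 ?_
    refine Eq.symm (Eq.trans this ?_)
    simp
    ring
  have hk0' : 0 < k 0 := by rw [hk0]; positivity
  set v : ℝ → ℝ := fun x => x * √(2 * k x) with hv_def
  have hs : AnalyticAt ℝ (fun x => √(2 * k x)) 0 :=
    (analyticAt_const.mul hk).sqrt_of_pos (mul_pos two_pos hk0')
  have hv : AnalyticAt ℝ v 0 := analyticAt_id.mul hs
  have hv0 : v 0 = 0 := by simp [hv_def]
  have hvd : HasDerivAt v (√(2 * k 0)) 0 := by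
    refine ((hasDerivAt_id (0 : ℝ)).mul hs.differentiableAt.hasDerivAt).congr_deriv ?_
    simp
  have hvpos : 0 < √(2 * k 0) := by positivity
  have hv2 : ∀ᶠ x in 𝓝 (0 : ℝ), v x ^ 2 / 2 = potential g x := by
    filter_upwards [hk.continuousAt.eventually (lt_mem_nhds hk0')] with x hx
    rw [hGk, hv_def]
    simp only [mul_pow]
    rw [Real.sq_sqrt (by positivity)]
    ring
  have hvd0 : deriv v 0 ≠ 0 := by rw [hvd.deriv]; exact hvpos.ne'
  set h := hv.hasStrictDerivAt.localInverse _ _ _ hvd0 with hh_def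
  have hh : AnalyticAt ℝ h 0 := by simpa only [hv0] using hv.analyticAt_localInverse hvd0
  have hright : ∀ᶠ y in 𝓝 (0 : ℝ), v (h y) = y := by
    simpa only [hv0] using hv.hasStrictDerivAt.eventually_right_inverse hvd0
  have hleft : ∀ᶠ x in 𝓝 (0 : ℝ), h (v x) = x :=
    hv.hasStrictDerivAt.eventually_left_inverse hvd0
  have hvt : Tendsto v (𝓝 0) (𝓝 0) := by simpa [hv0] using hv.continuousAt.tendsto
  have hh0 : h 0 = 0 := by simpa [hv0] using hleft.self_of_nhds
  have hmul : ∀ᶠ x in 𝓝 (0 : ℝ), deriv h (v x) * deriv v x = 1 := by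
    filter_upwards [hleft.eventually_nhds, hvt.eventually hh.eventually_analyticAt,
      hv.eventually_analyticAt] with x hx h1 h2
    have := h1.differentiableAt.hasDerivAt.comp x h2.differentiableAt.hasDerivAt
    have e : h ∘ v =ᶠ[𝓝 x] id := hx
    exact (this.congr_of_eventuallyEq e.symm).unique (hasDerivAt_id x)
  have hd0 : 0 < deriv h 0 := by
    have := hmul.self_of_nhds
    rw [hv0, hvd.deriv] at this
    exact pos_of_mul_pos_left (this.symm ▸ one_pos) hvpos.le
  -- The speed is `p = h'`, where `h` is the local inverse of `v`; its primitive is then `h` itself.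
  obtain ⟨p, hp, hpe⟩ := exists_isSpeed_eventuallyEq hh.deriv.continuousAt
    (hh.deriv.eventually_analyticAt.mono fun _ h => h.continuousAt) hd0
  have hpa : AnalyticAt ℝ p 0 := hh.deriv.congr hpe.symm
  have hprim : primitive p =ᶠ[𝓝 0] h := by
    obtain ⟨ρ, hρ, hb⟩ := Metric.eventually_nhds_iff_ball.1 (hpe.and hh.eventually_analyticAt)
    filter_upwards [Metric.ball_mem_nhds 0 hρ] with x hx
    have hsub : Set.uIcc 0 x ⊆ Metric.ball 0 ρ := by
      rw [← segment_eq_uIcc]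
      exact (convex_ball _ _).segment_subset (by simpa) hx
    rw [primitive, intervalIntegral.integral_eq_sub_of_hasDerivAt (f := h) (fun u hu => ?_)
      (hp.continuous.intervalIntegrable _ _), hh0, sub_zero]
    rw [(hb u (hsub hu)).1]
    exact (hb u (hsub hu)).2.differentiableAt.hasDerivAt
  refine ⟨p, hp, hpa, ?_⟩
  have hcoord : ∀ᶠ x in 𝓝 (0 : ℝ), coord p x = v x := by
    filter_upwards [hvt.eventually hprim, hleft] with x h1 h2
    rw [← hp.coord_primitive (v x), h1, h2]
  filter_upwards [hcoord, hmul, hvt.eventually hpe, hv2.eventually_nhds, hGd,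
    hv.eventually_analyticAt] with x h1 h2 h3 h4 h5 h6
  have h7 := ((h6.differentiableAt.hasDerivAt.pow 2).div_const 2)
  -- Differentiating `v ^ 2 / 2 = G` gives `v * v' = g`, and `v' = 1 / h' (v)`.
  have h8 : (fun x => v x ^ 2 / 2) =ᶠ[𝓝 x] potential g := h4
  have h9 := (h7.congr_of_eventuallyEq h8.symm).unique h5
  rw [force, h1, h3, ← h9, eq_div_iff (left_ne_zero_of_mul_eq_one h2)]
  simp only [Nat.cast_ofNat, Nat.add_one_sub_one, pow_one]
  linear_combination v x * h2

/-! ### Explicit orbits and their periods -/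

/-- The speed of the time variable with respect to the angle, along the orbit of amplitude `r`. -/
noncomputable def angleSpeed (p : ℝ → ℝ) (r s : ℝ) : ℝ := p (r * Real.sin s)

/-- The orbit of amplitude `r` of the system given by `force p`, with phase `c`. -/
noncomputable def orbit (p : ℝ → ℝ) (r c t : ℝ) : ℝ × ℝ :=
  (primitive p (r * Real.sin (coord (angleSpeed p r) (t + c))),
    r * Real.cos (coord (angleSpeed p r) (t + c)))

/-- The period of the orbit of amplitude `r`. -/
noncomputable def orbitPeriod (p : ℝ → ℝ) (r : ℝ) : ℝ :=
  primitive (angleSpeed p r) (2 * Real.pi)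

theorem orbit_add (p : ℝ → ℝ) (r c t : ℝ) : orbit p r (t + c) 0 = orbit p r c t := by
  simp [orbit]

theorem exists_polar (u y : ℝ) :
    ∃ θ, u = √(u ^ 2 + y ^ 2) * Real.sin θ ∧ y = √(u ^ 2 + y ^ 2) * Real.cos θ := by
  have h : ‖(⟨y, u⟩ : ℂ)‖ = √(u ^ 2 + y ^ 2) := by
    rw [Complex.norm_eq_sqrt_sq_add_sq, add_comm]
  exact ⟨Complex.arg ⟨y, u⟩, by rw [← h, Complex.norm_mul_sin_arg],
    by rw [← h, Complex.norm_mul_cos_arg]⟩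

namespace IsSpeed

variable {p : ℝ → ℝ} (hp : IsSpeed p)
include hp

theorem angleSpeed (r : ℝ) : IsSpeed (angleSpeed p r) := by
  obtain ⟨m, hm, h⟩ := hp.bound
  refine ⟨?_, m, hm, fun u => h _⟩
  have := hp.continuous
  unfold ChouikhaIsochronous.angleSpeed
  fun_prop

theorem orbit_phase (r θ : ℝ) :
    orbit p r (primitive (ChouikhaIsochronous.angleSpeed p r) θ) 0
      = (primitive p (r * Real.sin θ), r * Real.cos θ) := by
  simp [orbit, (hp.angleSpeed r).coord_primitive]

theorem hasDerivAt_orbit (r c t : ℝ) :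
    HasDerivAt (orbit p r c) ((orbit p r c t).2, -force p (orbit p r c t).1) t := by
  have hθ := ((hp.angleSpeed r).hasDerivAt_coord (t + c)).comp_add_const t c
  have hpos := (hp.pos (r * Real.sin (coord (ChouikhaIsochronous.angleSpeed p r) (t + c)))).ne'
  refine HasDerivAt.prodMk ?_ ?_
  · refine ((hp.hasDerivAt_primitive _).comp t (hθ.sin.const_mul r)).congr_deriv ?_
    simp only [orbit, ChouikhaIsochronous.angleSpeed]
    field_simp
  · refine (hθ.cos.const_mul r).congr_deriv ?_
    simp only [orbit, hp.force_primitive, ChouikhaIsochronous.angleSpeed]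
    field_simp

theorem primitive_angleSpeed_add (r θ : ℝ) :
    primitive (ChouikhaIsochronous.angleSpeed p r) (θ + 2 * Real.pi)
      = primitive (ChouikhaIsochronous.angleSpeed p r) θ + orbitPeriod p r := by
  have hper : Function.Periodic (ChouikhaIsochronous.angleSpeed p r) (2 * Real.pi) := fun s => by
    simp [ChouikhaIsochronous.angleSpeed]
  have := hper.intervalIntegral_add_eq θ 0
  rw [zero_add] at this
  rw [orbitPeriod, primitive, primitive, primitive, ← this,
    intervalIntegral.integral_add_adjacent_intervals] <;>
  exact (hp.angleSpeed r).continuous.intervalIntegrable _ _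

theorem orbitPeriod_pos (r : ℝ) : 0 < orbitPeriod p r := by
  have := (hp.angleSpeed r).strictMono_primitive Real.two_pi_pos
  rwa [primitive_zero] at this

theorem periodic_orbit (r c : ℝ) : Function.Periodic (orbit p r c) (orbitPeriod p r) := by
  intro t
  have h : coord (ChouikhaIsochronous.angleSpeed p r) (t + orbitPeriod p r + c)
      = coord (ChouikhaIsochronous.angleSpeed p r) (t + c) + 2 * Real.pi := by
    rw [← (hp.angleSpeed r).coord_primitive (coord _ _ + _), hp.primitive_angleSpeed_add,
      (hp.angleSpeed r).primitive_coord, add_right_comm]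
  simp [orbit, h]

theorem isLeast_orbitPeriod {r : ℝ} (hr : 0 < r) (c : ℝ) :
    IsLeast {S : ℝ | 0 < S ∧ Function.Periodic (orbit p r c) S} (orbitPeriod p r) := by
  refine ⟨⟨hp.orbitPeriod_pos r, hp.periodic_orbit r c⟩, ?_⟩
  rintro S ⟨hS, hper⟩
  -- At time `-c` the angle is `0` and the second component is `r`. Its return after time `S` forces
  -- `cos = 1`, so the angle is a positive multiple of `2π`.
  have h := congrArg Prod.snd (hper (-c))
  have hA := hp.angleSpeed r
  simp only [orbit, neg_add_cancel, hA.coord_zero, Real.cos_zero, neg_add_cancel_comm] at h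
  obtain ⟨n, hn⟩ := (Real.cos_eq_one_iff _).1 (mul_left_cancel₀ hr.ne' h)
  have hpos : 0 < coord (ChouikhaIsochronous.angleSpeed p r) S := by
    simpa [hA.coord_zero] using hA.strictMono_coord hS
  have hn1 : (1 : ℝ) ≤ n := by
    rw [← hn] at hpos
    have : (0 : ℝ) < n := pos_of_mul_pos_left hpos Real.two_pi_pos.le
    exact_mod_cast this
  rw [← hA.primitive_coord S, orbitPeriod]
  refine hA.strictMono_primitive.monotone ?_
  rw [← hn]
  nlinarith [Real.two_pi_pos]

theorem exists_phase (q : ℝ × ℝ) : ∃ c, orbit p (√(coord p q.1 ^ 2 + q.2 ^ 2)) c 0 = q := by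
  obtain ⟨θ, h1, h2⟩ := exists_polar (coord p q.1) q.2
  refine ⟨_, (hp.orbit_phase _ θ).trans ?_⟩
  rw [← h1, ← h2, hp.primitive_coord]

theorem mem_range_orbit {r : ℝ} (hr : 0 < r) (c : ℝ) (q : ℝ × ℝ) :
    q ∈ Set.range (orbit p r c) ↔ coord p q.1 ^ 2 + q.2 ^ 2 = r ^ 2 := by
  constructor
  · rintro ⟨t, rfl⟩
    simp only [orbit, hp.coord_primitive]
    linear_combination
      r ^ 2 * Real.sin_sq_add_cos_sq (coord (ChouikhaIsochronous.angleSpeed p r) (t + c))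
  · intro h
    obtain ⟨c', hc'⟩ := hp.exists_phase q
    rw [h, Real.sqrt_sq hr.le] at hc'
    exact ⟨c' - c, by rw [← orbit_add, sub_add_cancel, hc']⟩

/-- The orbit is a whole level set of the first integral `V`. By the intermediate value theorem, a
connected set through the origin that avoids it stays in the bounded region `V < r ^ 2`. -/
theorem surroundsOrigin_orbit {r : ℝ} (hr : 0 < r) (c : ℝ) :
    SurroundsOrigin (Set.range (orbit p r c)) := by
  have h0 : (0 : ℝ × ℝ) ∉ Set.range (orbit p r c) := by
    rw [hp.mem_range_orbit hr]
    simpa [hp.coord_zero] using (pow_pos hr 2).ne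
  refine ⟨h0, ?_⟩
  set V : ℝ × ℝ → ℝ := fun q => coord p q.1 ^ 2 + q.2 ^ 2
  have hV : Continuous V := by
    have := hp.continuous_coord
    fun_prop
  have hsub : ∀ q ∈ connectedComponentIn (Set.range (orbit p r c))ᶜ (0 : ℝ × ℝ), V q < r ^ 2 := by
    intro q hq
    by_contra! hle
    obtain ⟨q', hq', he⟩ := isPreconnected_connectedComponentIn.intermediate_value
      (mem_connectedComponentIn h0) hq hV.continuousOn
      (show r ^ 2 ∈ Set.Icc (V 0) (V q) from ⟨by simp [V, hp.coord_zero]; positivity, hle⟩)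
    exact connectedComponentIn_subset _ _ hq' ((hp.mem_range_orbit hr c q').2 he)
  refine ((Metric.isBounded_Icc (primitive p (-r)) (primitive p r)).prod
    (Metric.isBounded_Icc (-r) r)).subset fun q hq => ?_
  have hq := hsub q hq
  have h1 := abs_le.1 (abs_le_of_sq_le_sq (show coord p q.1 ^ 2 ≤ r ^ 2 by
    simp only [V] at hq; nlinarith [sq_nonneg q.2]) hr.le)
  have h2 := abs_le.1 (abs_le_of_sq_le_sq (show q.2 ^ 2 ≤ r ^ 2 by
    simp only [V] at hq; nlinarith [sq_nonneg (coord p q.1)]) hr.le)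
  refine ⟨⟨?_, ?_⟩, h2⟩
  · simpa [hp.primitive_coord] using hp.strictMono_primitive.monotone h1.1
  · simpa [hp.primitive_coord] using hp.strictMono_primitive.monotone h1.2

theorem isClosedOrbit_orbit {D : Set ℝ} {g : ℝ → ℝ} {r : ℝ} (hr : 0 < r) (c : ℝ)
    (hD : ∀ u, |u| ≤ r → primitive p u ∈ D ∧ g (primitive p u) = force p (primitive p u)) :
    IsClosedOrbit D g (orbit p r c) (orbitPeriod p r) := by
  refine ⟨fun t => ?_, hp.isLeast_orbitPeriod hr c, hp.surroundsOrigin_orbit hr c⟩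
  have h := hD (r * Real.sin (coord (ChouikhaIsochronous.angleSpeed p r) (t + c))) (by
    rw [abs_mul, abs_of_pos hr]
    exact mul_le_of_le_one_right hr.le (Real.abs_sin_le_one _))
  refine ⟨h.1, ?_⟩
  have e : g (orbit p r c t).1 = force p (orbit p r c t).1 := h.2
  rw [e]
  exact hp.hasDerivAt_orbit r c t

/-- Shifting the second half turn by `π` changes the sign of the sine, so only the even part of `p`
contributes. -/
theorem orbitPeriod_eq (r : ℝ) : orbitPeriod p r =
    ∫ s in (0 : ℝ)..Real.pi, (p (r * Real.sin s) + p (-(r * Real.sin s))) := by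
  have hc := hp.continuous
  have hA := (hp.angleSpeed r).continuous
  rw [intervalIntegral.integral_add (Continuous.intervalIntegrable (by fun_prop) _ _)
    (Continuous.intervalIntegrable (by fun_prop) _ _)]
  have h := intervalIntegral.integral_comp_add_right (a := 0) (b := Real.pi)
    (ChouikhaIsochronous.angleSpeed p r) Real.pi
  simp only [ChouikhaIsochronous.angleSpeed, Real.sin_add_pi, mul_neg, zero_add] at h
  rw [h, orbitPeriod, primitive, two_mul]
  exact (intervalIntegral.integral_add_adjacent_intervals (hA.intervalIntegrable _ _)
    (hA.intervalIntegrable _ _)).symm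

theorem eventually_orbitPeriod_eq {C : ℝ} (h : ∀ᶠ u in 𝓝 (0 : ℝ), p u + p (-u) = C) :
    ∀ᶠ r in 𝓝 (0 : ℝ), orbitPeriod p r = Real.pi * C := by
  obtain ⟨ρ, hρ, h⟩ := Metric.eventually_nhds_iff.1 h
  refine Metric.eventually_nhds_iff.2 ⟨ρ, hρ, fun r hr => ?_⟩
  rw [hp.orbitPeriod_eq]
  have : ∀ s, p (r * Real.sin s) + p (-(r * Real.sin s)) = C := fun s => by
    refine h ?_
    simp only [dist_zero_right, Real.norm_eq_abs, abs_mul] at hr ⊢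
    exact (mul_le_of_le_one_right (abs_nonneg _) (Real.abs_sin_le_one _)).trans_lt hr
  simp [this]

/-- Otherwise, by isolation of zeros, `p u + p (-u) - T / π` has no zero on some `(0, ρ]`. But its
integral along `u = ρ sin s`, `0 ≤ s ≤ π`, vanishes, and Rolle's theorem yields a zero. -/
theorem eventually_add_neg_eq_of_orbitPeriod (ha : AnalyticAt ℝ p 0) {T : ℝ}
    (h : ∀ᶠ r in 𝓝[>] (0 : ℝ), orbitPeriod p r = T) :
    ∀ᶠ u in 𝓝 (0 : ℝ), p u + p (-u) = T / Real.pi := by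
  have hn : AnalyticAt ℝ (fun u => p (-u)) 0 :=
    AnalyticAt.comp (by simpa using ha) analyticAt_id.neg
  have hq : AnalyticAt ℝ (fun u => p u + p (-u) - T / Real.pi) 0 :=
    (ha.add hn).sub analyticAt_const
  rcases hq.eventually_eq_zero_or_eventually_ne_zero with hz | hz
  · exact hz.mono fun u hu => sub_eq_zero.1 hu
  · exfalso
    have hz : ∀ᶠ u in 𝓝[>] (0 : ℝ), p u + p (-u) - T / Real.pi ≠ 0 :=
      hz.filter_mono (nhdsWithin_mono _ fun x hx => ne_of_gt hx)
    obtain ⟨ρ, hρ, hb⟩ := mem_nhdsGT_iff_exists_Ioc_subset.1 (h.and hz)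
    have hcont : Continuous fun s => p (ρ * Real.sin s) + p (-(ρ * Real.sin s)) - T / Real.pi := by
      have := hp.continuous
      fun_prop
    have hF : ∀ x, HasDerivAt
        (fun x => ∫ s in (0 : ℝ)..x, (p (ρ * Real.sin s) + p (-(ρ * Real.sin s)) - T / Real.pi))
        (p (ρ * Real.sin x) + p (-(ρ * Real.sin x)) - T / Real.pi) x := fun x =>
      intervalIntegral.integral_hasDerivAt_right (hcont.intervalIntegrable _ _)
        (hcont.stronglyMeasurableAtFilter _ _) hcont.continuousAt
    obtain ⟨s, hs, hs0⟩ := exists_hasDerivAt_eq_zero Real.pi_pos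
      (fun x _ => (hF x).continuousAt.continuousWithinAt) (by
        have hc := hp.continuous
        rw [intervalIntegral.integral_same, intervalIntegral.integral_sub
          (Continuous.intervalIntegrable (by fun_prop) _ _) (by simp), ← hp.orbitPeriod_eq,
          (hb ⟨hρ, le_rfl⟩).1]
        simp) fun x _ => hF x
    have hs' := Real.sin_pos_of_mem_Ioo hs
    exact (hb (show ρ * Real.sin s ∈ Set.Ioc 0 ρ from
      ⟨mul_pos hρ hs', mul_le_of_le_one_right (le_of_lt hρ) (Real.sin_le_one s)⟩)).2 hs0

end IsSpeed

/-! ### Uniqueness of closed orbits -/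

theorem IsClosedOrbit.exists_abs_fst_le {ε : ℝ} {g : ℝ → ℝ} {γ : ℝ → ℝ × ℝ} {T : ℝ}
    (h : IsClosedOrbit (Set.Ioo (-ε) ε) g γ T) : ∃ a < ε, ∀ t, |(γ t).1| ≤ a := by
  have hc : Continuous γ := continuous_iff_continuousAt.2 fun t => (h.solution t).2.continuousAt
  have hK := h.period.1.2.compact_of_continuous h.period.1.1.ne' hc
  obtain ⟨_, ⟨t, rfl⟩, ht⟩ := hK.exists_isMaxOn (Set.range_nonempty γ)
    (f := fun q => |q.1|) (by fun_prop)
  exact ⟨_, abs_lt.2 (h.solution t).1, fun s => ht ⟨s, rfl⟩⟩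

/-- Identifies the unspecified orbits in the definition of an isochronous center with the explicit
ones. Closed orbits are compact, so both lie over a compact subinterval, where `g` is Lipschitz. -/
theorem IsClosedOrbit.eq_of_apply_zero_eq {ε : ℝ} {g : ℝ → ℝ}
    (hg : AnalyticOnNhd ℝ g (Set.Ioo (-ε) ε)) {γ γ' : ℝ → ℝ × ℝ} {T T' : ℝ}
    (h : IsClosedOrbit (Set.Ioo (-ε) ε) g γ T) (h' : IsClosedOrbit (Set.Ioo (-ε) ε) g γ' T')
    (h0 : γ 0 = γ' 0) : γ = γ' := by
  obtain ⟨a, ha, hγ⟩ := h.exists_abs_fst_le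
  obtain ⟨a', ha', hγ'⟩ := h'.exists_abs_fst_le
  set b := max a a'
  have hb : b < ε := max_lt ha ha'
  have hsub : Set.Icc (-b) b ⊆ Set.Ioo (-ε) ε := Set.Icc_subset_Ioo (by linarith) hb
  obtain ⟨K, hK⟩ := ContDiffOn.exists_lipschitzOnWith (n := 1)
    (fun x hx => (hg x (hsub hx)).contDiffAt.contDiffWithinAt) one_ne_zero
    (convex_Icc (-b) b) isCompact_Icc
  have hL : LipschitzOnWith (max 1 (K * 1)) (fun q : ℝ × ℝ => (q.2, -g q.1))
      (Set.Icc (-b) b ×ˢ Set.univ) :=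
    LipschitzWith.prod_snd.lipschitzOnWith.prodMk
      ((hK.comp (LipschitzWith.prod_fst.lipschitzOnWith) fun q hq => hq.1).neg)
  refine ODE_solution_unique_univ (v := fun _ q => (q.2, -g q.1)) (t₀ := 0) (fun _ => hL)
    (fun t => ⟨(h.solution t).2, ?_⟩) (fun t => ⟨(h'.solution t).2, ?_⟩) h0
  · exact ⟨abs_le.1 ((hγ t).trans (le_max_left _ _)), trivial⟩
  · exact ⟨abs_le.1 ((hγ' t).trans (le_max_right _ _)), trivial⟩

/-! ### The Chouikha equation in the coordinate `u` -/

theorem eventuallyEq_of_hasDerivAt {a b c : ℝ → ℝ} (ha : ∀ᶠ u in 𝓝 (0 : ℝ), HasDerivAt a (c u) u)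
    (hb : ∀ᶠ u in 𝓝 (0 : ℝ), HasDerivAt b (c u) u) (h0 : a 0 = b 0) : a =ᶠ[𝓝 0] b := by
  obtain ⟨ρ, hρ, h⟩ := Metric.eventually_nhds_iff_ball.1 (ha.and hb)
  filter_upwards [Metric.ball_mem_nhds 0 hρ] with x hx
  refine Metric.isOpen_ball.eqOn_of_deriv_eq (convex_ball 0 ρ).isPreconnected
    (fun u hu => (h u hu).1.differentiableAt.differentiableWithinAt)
    (fun u hu => (h u hu).2.differentiableAt.differentiableWithinAt)
    (fun u hu => ?_) (Metric.mem_ball_self hρ) h0 hx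
  rw [(h u hu).1.deriv, (h u hu).2.deriv]

theorem tendsto_neg_zero : Tendsto (fun u : ℝ => -u) (𝓝 0) (𝓝 0) := by
  simpa using (continuous_neg (G := ℝ)).tendsto 0

theorem IsSpeed.solvesChouikha_iff {p f f' g : ℝ → ℝ} (hp : IsSpeed p) (ha : AnalyticAt ℝ p 0)
    (hf : f =ᶠ[𝓝 0] f') (hg : g =ᶠ[𝓝 0] force p) :
    SolvesChouikha f g ↔ ∀ᶠ u in 𝓝 (0 : ℝ), HasDerivAt p (f' (u ^ 2 / 2)) u := by
  have hpot : ∀ᶠ x in 𝓝 (0 : ℝ), potential g x = coord p x ^ 2 / 2 := by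
    filter_upwards [potential_congr hg] with x hx
    rw [hx, hp.potential_force]
  have hquot : ∀ᶠ x in 𝓝[≠] (0 : ℝ),
      g x ≠ 0 ∧ potential g x / g x ^ 2 = p (coord p x) ^ 2 / 2 := by
    filter_upwards [hpot.filter_mono nhdsWithin_le_nhds, hg.filter_mono nhdsWithin_le_nhds,
      self_mem_nhdsWithin] with x h1 h2 h3
    have h3 : x ≠ 0 := h3
    refine ⟨by rwa [h2, ne_eq, hp.force_eq_zero], ?_⟩
    rw [h1, h2, force]
    have := (hp.pos (coord p x)).ne'
    have := hp.coord_eq_zero.not.2 h3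
    field_simp
  have hrhs : ∀ᶠ x in 𝓝 (0 : ℝ), f (potential g x) = f' (coord p x ^ 2 / 2) := by
    have : Tendsto (fun x => coord p x ^ 2 / 2) (𝓝 0) (𝓝 0) := by
      simpa using (hp.tendsto_coord.pow 2).div_const 2
    filter_upwards [hpot, this.eventually hf] with x h1 h2
    rw [h1, h2]
  have hder : ∀ᶠ x in 𝓝 (0 : ℝ),
      HasDerivAt (fun x => p (coord p x) ^ 2 / 2) (deriv p (coord p x)) x := by
    filter_upwards [hp.tendsto_coord.eventually ha.eventually_analyticAt] with x hx
    refine (((hx.differentiableAt.hasDerivAt.comp x (hp.hasDerivAt_coord x)).pow 2).div_const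
      2).congr_deriv ?_
    have := (hp.pos (coord p x)).ne'
    simp
    field_simp
  constructor
  · rintro ⟨Q, hQ, hQd⟩
    have hQe : Q =ᶠ[𝓝[≠] 0] fun x => p (coord p x) ^ 2 / 2 := by
      filter_upwards [hQ, hquot] with x h1 h2
      rw [h1.2, h2.2]
    -- Both functions are continuous at `0`, so their equality extends across the puncture.
    have hQe := (hQd.self_of_nhds.continuousAt.eventuallyEq_nhds_iff_eventuallyEq_nhdsNE
      hder.self_of_nhds.continuousAt).1 hQe
    have hx : ∀ᶠ x in 𝓝 (0 : ℝ), HasDerivAt p (f' (coord p x ^ 2 / 2)) (coord p x) := by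
      filter_upwards [hQe.eventually_nhds, hQd, hder, hrhs,
        hp.tendsto_coord.eventually ha.eventually_analyticAt] with x h1 h2 h3 h4 h5
      rw [← h4, h2.unique (h3.congr_of_eventuallyEq h1)]
      exact h5.differentiableAt.hasDerivAt
    filter_upwards [hp.tendsto_primitive.eventually hx] with u hu
    rwa [hp.coord_primitive] at hu
  · intro h
    refine ⟨fun x => p (coord p x) ^ 2 / 2, hquot.mono fun x hx => ⟨hx.1, hx.2.symm⟩, ?_⟩
    filter_upwards [hder, hrhs, hp.tendsto_coord.eventually h] with x h1 h2 h3
    rwa [h2, ← h3.deriv]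

theorem exists_isSpeed_hasDerivAt {f : ℝ → ℝ} (hf : AnalyticAt ℝ f 0) {l : ℝ} (hl : 0 < l) :
    ∃ p, IsSpeed p ∧ AnalyticAt ℝ p 0 ∧ p 0 = l ∧
      ∀ᶠ u in 𝓝 (0 : ℝ), HasDerivAt p (f (u ^ 2 / 2)) u := by
  have hs : AnalyticAt ℝ (fun u : ℝ => u ^ 2 / 2) 0 := by fun_prop
  have hF : AnalyticAt ℝ (fun u => f (u ^ 2 / 2)) 0 :=
    AnalyticAt.comp (g := f) (f := fun u : ℝ => u ^ 2 / 2) (by simpa using hf) hs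
  set P : ℝ → ℝ := fun u => l + primitive (fun u => f (u ^ 2 / 2)) u with hP_def
  have hP : AnalyticAt ℝ P 0 := analyticAt_const.add (analyticAt_zero_integral hF)
  have hP0 : P 0 = l := by simp [hP_def]
  have hPd : ∀ᶠ u in 𝓝 (0 : ℝ), HasDerivAt P (f (u ^ 2 / 2)) u :=
    (eventually_hasDerivAt_primitive hF).mono fun u hu => hu.const_add l
  obtain ⟨p, hp, hpe⟩ := exists_isSpeed_eventuallyEq hP.continuousAt
    (hP.eventually_analyticAt.mono fun _ h => h.continuousAt) (hP0 ▸ hl)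
  refine ⟨p, hp, hP.congr hpe.symm, hpe.self_of_nhds.trans hP0, ?_⟩
  filter_upwards [hPd, hpe.eventually_nhds] with u h1 h2
  exact h1.congr_of_eventuallyEq h2

/-- Since `p'` is even, `p u` and `2 * p 0 - p (-u)` have the same derivative and the same value at
`0`. -/
theorem eventually_add_neg_eq_of_hasDerivAt {p f : ℝ → ℝ}
    (h : ∀ᶠ u in 𝓝 (0 : ℝ), HasDerivAt p (f (u ^ 2 / 2)) u) :
    ∀ᶠ u in 𝓝 (0 : ℝ), p u + p (-u) = 2 * p 0 := by
  have : p =ᶠ[𝓝 0] fun u => 2 * p 0 - p (-u) := by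
    refine eventuallyEq_of_hasDerivAt h ?_ (by simp; ring)
    filter_upwards [tendsto_neg_zero.eventually h] with u hu
    refine ((hu.comp u (hasDerivAt_neg u)).const_sub (2 * p 0)).congr_deriv ?_
    simp
  filter_upwards [this] with u hu
  rw [hu]
  ring

theorem exists_hasDerivAt_comp_sq {p : ℝ → ℝ} (ha : AnalyticAt ℝ p 0) {C : ℝ}
    (h : ∀ᶠ u in 𝓝 (0 : ℝ), p u + p (-u) = C) :
    ∃ f : ℝ → ℝ, AnalyticAt ℝ f 0 ∧ ∀ᶠ u in 𝓝 (0 : ℝ), HasDerivAt p (f (u ^ 2 / 2)) u := by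
  obtain ⟨f, hf, hfe⟩ := exists_analyticAt_comp_sq ha.deriv (by
    filter_upwards [h.eventually_nhds, ha.eventually_analyticAt,
      tendsto_neg_zero.eventually ha.eventually_analyticAt] with u h1 h2 h3
    have h4 := h2.differentiableAt.hasDerivAt.add
      (h3.differentiableAt.hasDerivAt.comp u (hasDerivAt_neg u))
    have h5 : (p + p ∘ fun u => -u) =ᶠ[𝓝 u] fun _ => C := h1
    have h6 := (h4.congr_of_eventuallyEq h5.symm).unique (hasDerivAt_const u C)
    linarith)
  refine ⟨f, hf, ?_⟩
  filter_upwards [hfe, ha.eventually_analyticAt] with u h1 h2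
  rw [← h1]
  exact h2.differentiableAt.hasDerivAt

/-! ### Isochrony in terms of `p` -/

/-- An orbit of small amplitude is a closed orbit of any system on `D × ℝ` that coincides with
the one of `force p` near the origin. -/
theorem IsSpeed.eventually_isClosedOrbit {p g : ℝ → ℝ} (hp : IsSpeed p) {D : Set ℝ}
    (hD : D ∈ 𝓝 (0 : ℝ)) (hg : g =ᶠ[𝓝 0] force p) :
    ∀ᶠ r in 𝓝 (0 : ℝ), 0 < r → ∀ c, IsClosedOrbit D g (orbit p r c) (orbitPeriod p r) := by
  obtain ⟨ρ, hρ, h⟩ := Metric.eventually_nhds_iff.1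
    (hp.tendsto_primitive.eventually (inter_mem hD hg))
  filter_upwards [Metric.ball_mem_nhds 0 hρ] with r hr hr0 c
  refine hp.isClosedOrbit_orbit hr0 c fun u hu => h ?_
  simp only [dist_zero_right, Real.norm_eq_abs, mem_ball_zero_iff, abs_of_pos hr0] at hr ⊢
  exact hu.trans_lt hr

theorem IsSpeed.isIsochronousCenter {p g : ℝ → ℝ} (hp : IsSpeed p) {D : Set ℝ}
    (hD : D ∈ 𝓝 (0 : ℝ)) (hg : g =ᶠ[𝓝 0] force p) {C : ℝ}
    (h : ∀ᶠ u in 𝓝 (0 : ℝ), p u + p (-u) = C) : IsIsochronousCenter D g := by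
  set A : ℝ × ℝ → ℝ := fun q => √(coord p q.1 ^ 2 + q.2 ^ 2) with hA_def
  have hA : Tendsto A (𝓝 0) (𝓝 0) := by
    have hc : Continuous A := by
      have := hp.continuous_coord
      fun_prop
    simpa [hA_def, hp.coord_zero] using hc.tendsto 0
  have hpos : ∀ q : ℝ × ℝ, q ≠ 0 → 0 < A q := by
    intro q hq
    refine Real.sqrt_pos.2 (lt_of_le_of_ne (by positivity) fun h0 => hq ?_)
    have h1 : coord p q.1 = 0 := by nlinarith [sq_nonneg (coord p q.1), sq_nonneg q.2]
    have h2 : q.2 = 0 := by nlinarith [sq_nonneg (coord p q.1), sq_nonneg q.2]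
    exact Prod.ext (hp.coord_eq_zero.1 h1) h2
  have key : ∀ᶠ q in 𝓝 (0 : ℝ × ℝ), q ≠ 0 →
      ∃ γ : ℝ → ℝ × ℝ, γ 0 = q ∧ IsClosedOrbit D g γ (Real.pi * C) := by
    filter_upwards [hA.eventually (hp.eventually_isClosedOrbit hD hg),
      hA.eventually (hp.eventually_orbitPeriod_eq h)] with q h1 h2 hq
    obtain ⟨c, hc⟩ := hp.exists_phase q
    exact ⟨_, hc, h2 ▸ h1 (hpos q hq) c⟩
  refine ⟨⟨?_, _, key, fun q hq hq0 => ?_⟩, Real.pi * C, _, key, fun q hq hq0 => hq hq0⟩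
  · rw [hg.self_of_nhds, hp.force_zero]
  · obtain ⟨γ, h1, h2⟩ := hq hq0
    exact ⟨γ, _, h1, h2⟩

theorem IsSpeed.exists_eventually_orbitPeriod_eq {p g : ℝ → ℝ} (hp : IsSpeed p) {ε : ℝ}
    (hε : 0 < ε) (hga : AnalyticOnNhd ℝ g (Set.Ioo (-ε) ε)) (hg : g =ᶠ[𝓝 0] force p)
    (h : IsIsochronousCenter (Set.Ioo (-ε) ε) g) :
    ∃ T, ∀ᶠ r in 𝓝[>] (0 : ℝ), orbitPeriod p r = T := by
  obtain ⟨-, T, U, hU, hT⟩ := h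
  have ht : Tendsto (fun r : ℝ => ((0, r) : ℝ × ℝ)) (𝓝 0) (𝓝 0) :=
    (Continuous.prodMk_right (0 : ℝ)).tendsto 0
  refine ⟨T, ?_⟩
  filter_upwards [(ht.eventually hU).filter_mono nhdsWithin_le_nhds,
    (hp.eventually_isClosedOrbit (Ioo_mem_nhds (neg_lt_zero.2 hε) hε) hg).filter_mono
      nhdsWithin_le_nhds, self_mem_nhdsWithin] with r h1 h2 hr
  have hr : 0 < r := hr
  obtain ⟨γ, hγ0, hγ⟩ := hT _ h1 (by simp [hr.ne'])
  have h3 := h2 hr 0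
  -- The points `(0, r)` suffice as test points: each lies on the orbit of amplitude `r`, at angle
  -- `0`.
  have h4 : orbit p r 0 0 = (0, r) := by simpa using hp.orbit_phase r 0
  have := hγ.eq_of_apply_zero_eq hga h3 (hγ0.trans h4.symm)
  subst this
  exact h3.period.unique hγ.period

/-! ### The correspondence between germs -/

theorem IsSpeed.force_mem_isochronousGerms {p : ℝ → ℝ} (hp : IsSpeed p) (ha : AnalyticAt ℝ p 0)
    {C : ℝ} (h : ∀ᶠ u in 𝓝 (0 : ℝ), p u + p (-u) = C) :
    (force p : RealGerm) ∈ isochronousGerms := by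
  obtain ⟨ε, hε, hb⟩ := Metric.eventually_nhds_iff_ball.1
    (hp.analyticAt_force ha).eventually_analyticAt
  refine ⟨force p, ε, rfl, hε, fun x hx => hb x ?_, hp.force_zero, ?_,
    hp.isIsochronousCenter (Ioo_mem_nhds (neg_lt_zero.2 hε) hε) .rfl h⟩
  · rwa [Real.ball_eq_Ioo, zero_sub, zero_add]
  · rw [hp.deriv_force_zero ha]
    have := hp.pos 0
    positivity

theorem IsAnalyticSolutionGerm.exists_isSpeed {f : ℝ → ℝ} {lam : ℝ} (hlam : 0 < lam)
    {ψ : RealGerm} (h : IsAnalyticSolutionGerm (f : RealGerm) lam ψ) :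
    ∃ p, IsSpeed p ∧ AnalyticAt ℝ p 0 ∧ p 0 = lam⁻¹ ∧ ψ = (force p : RealGerm) ∧
      ∀ᶠ u in 𝓝 (0 : ℝ), HasDerivAt p (f (u ^ 2 / 2)) u := by
  obtain ⟨f', g, hf, rfl, hfa, hga, hg0, hgd, hs⟩ := h
  obtain ⟨p, hp, ha, hgp⟩ := exists_eventuallyEq_force hga hg0 (by rw [hgd]; positivity)
  refine ⟨p, hp, ha, ?_, Germ.coe_eq.2 hgp,
    (hp.solvesChouikha_iff ha (Germ.coe_eq.1 hf).symm hgp).1 hs⟩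
  rw [hgp.deriv_eq, hp.deriv_force_zero ha, ← inv_pow] at hgd
  rw [← (pow_left_inj₀ (inv_pos.2 (hp.pos 0)).le hlam.le two_ne_zero).1 hgd, inv_inv]

theorem IsSpeed.isAnalyticSolutionGerm {p f : ℝ → ℝ} (hp : IsSpeed p) (ha : AnalyticAt ℝ p 0)
    (hf : AnalyticAt ℝ f 0) (h : ∀ᶠ u in 𝓝 (0 : ℝ), HasDerivAt p (f (u ^ 2 / 2)) u) :
    IsAnalyticSolutionGerm (f : RealGerm) (p 0)⁻¹ (force p : RealGerm) :=
  ⟨f, force p, rfl, rfl, hf, hp.analyticAt_force ha, hp.force_zero,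
    by rw [hp.deriv_force_zero ha, inv_pow], (hp.solvesChouikha_iff ha .rfl .rfl).2 h⟩

theorem existsUnique_isAnalyticSolutionGerm {f : ℝ → ℝ} (hf : AnalyticAt ℝ f 0) {lam : ℝ}
    (hlam : 0 < lam) : ∃ ψ ∈ isochronousGerms, IsAnalyticSolutionGerm (f : RealGerm) lam ψ ∧
      ∀ ψ', IsAnalyticSolutionGerm (f : RealGerm) lam ψ' → ψ' = ψ := by
  obtain ⟨p, hp, ha, hp0, hd⟩ := exists_isSpeed_hasDerivAt hf (inv_pos.2 hlam)
  refine ⟨_, hp.force_mem_isochronousGerms ha (eventually_add_neg_eq_of_hasDerivAt hd), ?_, ?_⟩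
  · simpa [hp0] using hp.isAnalyticSolutionGerm ha hf hd
  · intro ψ' h
    obtain ⟨q, hq, -, hq0, rfl, hqd⟩ := h.exists_isSpeed hlam
    exact Germ.coe_eq.2
      (force_congr hq hp (eventuallyEq_of_hasDerivAt hqd hd (hq0.trans hp0.symm)))

/-- The values `u ^ 2 / 2` reach only the nonnegative side of `0`; the identity principle covers the
other side. -/
theorem eventuallyEq_of_comp_sq {f₁ f₂ : ℝ → ℝ} (h₁ : AnalyticAt ℝ f₁ 0) (h₂ : AnalyticAt ℝ f₂ 0)
    (h : ∀ᶠ u in 𝓝 (0 : ℝ), f₁ (u ^ 2 / 2) = f₂ (u ^ 2 / 2)) : f₁ =ᶠ[𝓝 0] f₂ := by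
  refine (h₁.frequently_eq_iff_eventually_eq h₂).1 ?_
  have ht : Tendsto (fun w : ℝ => √(2 * w)) (𝓝 0) (𝓝 0) := by
    have : Continuous fun w : ℝ => √(2 * w) := by fun_prop
    simpa using this.tendsto 0
  have : ∀ᶠ w in 𝓝[>] (0 : ℝ), f₁ w = f₂ w := by
    filter_upwards [(ht.eventually h).filter_mono nhdsWithin_le_nhds, self_mem_nhdsWithin]
      with w hw hw0
    have hw0 : 0 < w := hw0
    rw [Real.sq_sqrt (by positivity)] at hw
    simpa using hw
  exact this.frequently.filter_mono (nhdsWithin_mono _ fun x hx => ne_of_gt hx)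

/-- A single speed `p` represents `ψ` in both equations; `p'` determines the germ of `f` and `p 0`
determines `lam`. -/
theorem IsAnalyticSolutionGerm.eq_of_eq {f₁ f₂ : ℝ → ℝ} {l₁ l₂ : ℝ} {ψ : RealGerm}
    (hf₁ : AnalyticAt ℝ f₁ 0) (hf₂ : AnalyticAt ℝ f₂ 0) (hl₁ : 0 < l₁) (hl₂ : 0 < l₂)
    (h₁ : IsAnalyticSolutionGerm (f₁ : RealGerm) l₁ ψ)
    (h₂ : IsAnalyticSolutionGerm (f₂ : RealGerm) l₂ ψ) :
    (f₁ : RealGerm) = (f₂ : RealGerm) ∧ l₁ = l₂ := by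
  obtain ⟨p, hp, ha, hp0, rfl, hd⟩ := h₁.exists_isSpeed hl₁
  obtain ⟨f, g, hf, hg, -, -, -, hgd, hs⟩ := h₂
  have hg := Germ.coe_eq.1 hg
  have hd₂ := (hp.solvesChouikha_iff ha (Germ.coe_eq.1 hf).symm hg.symm).1 hs
  constructor
  · refine Germ.coe_eq.2 (eventuallyEq_of_comp_sq hf₁ hf₂ ?_)
    filter_upwards [hd, hd₂] with u h1 h2
    exact h1.unique h2
  · rw [← hg.deriv_eq, hp.deriv_force_zero ha, hp0, inv_pow, inv_inv] at hgd
    exact (pow_left_inj₀ hl₁.le hl₂.le two_ne_zero).1 hgd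

theorem exists_isAnalyticSolutionGerm {ψ : RealGerm} (hψ : ψ ∈ isochronousGerms) :
    ∃ (f : ℝ → ℝ) (lam : ℝ), AnalyticAt ℝ f 0 ∧ 0 < lam ∧
      IsAnalyticSolutionGerm (f : RealGerm) lam ψ := by
  obtain ⟨g, ε, rfl, hε, hga, hg0, hgd, hiso⟩ := hψ
  obtain ⟨p, hp, ha, hgp⟩ := exists_eventuallyEq_force
    (hga 0 ⟨neg_lt_zero.2 hε, hε⟩) hg0 hgd
  obtain ⟨T, hT⟩ := hp.exists_eventually_orbitPeriod_eq hε hga hgp hiso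
  obtain ⟨f, hf, hd⟩ := exists_hasDerivAt_comp_sq ha (hp.eventually_add_neg_eq_of_orbitPeriod ha hT)
  refine ⟨f, (p 0)⁻¹, hf, inv_pos.2 (hp.pos 0), ?_⟩
  rw [Germ.coe_eq.2 hgp]
  exact hp.isAnalyticSolutionGerm ha hf hd

end ChouikhaIsochronous

theorem theorem4p1 :
    ∃ Φ : (ChouikhaIsochronous.analyticGerms × Set.Ioi (0 : ℝ)) ≃
        ChouikhaIsochronous.isochronousGerms,
      ∀ (φ : ChouikhaIsochronous.analyticGerms) (lam : Set.Ioi (0 : ℝ)),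
        ChouikhaIsochronous.IsAnalyticSolutionGerm φ lam (Φ (φ, lam)) ∧
        ∀ ψ : ChouikhaIsochronous.RealGerm,
          ChouikhaIsochronous.IsAnalyticSolutionGerm φ lam ψ →
            ψ = (Φ (φ, lam) : ChouikhaIsochronous.RealGerm) := by
  have key : ∀ x : ChouikhaIsochronous.analyticGerms × Set.Ioi (0 : ℝ),
      ∃ ψ : ChouikhaIsochronous.isochronousGerms,
        ChouikhaIsochronous.IsAnalyticSolutionGerm x.1 x.2 ψ ∧
        ∀ ψ' : ChouikhaIsochronous.RealGerm,
          ChouikhaIsochronous.IsAnalyticSolutionGerm x.1 x.2 ψ' →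
            ψ' = (ψ : ChouikhaIsochronous.RealGerm) := by
    rintro ⟨⟨_, f, hf, rfl⟩, lam, hlam⟩
    obtain ⟨ψ, hψ, h⟩ := ChouikhaIsochronous.existsUnique_isAnalyticSolutionGerm hf hlam
    exact ⟨⟨ψ, hψ⟩, h⟩
  choose Φ hΦ huniq using key
  refine ⟨Equiv.ofBijective Φ ⟨?_, ?_⟩, fun φ lam => ⟨hΦ (φ, lam), huniq (φ, lam)⟩⟩
  · rintro ⟨⟨φ₁, h₁⟩, l₁, hl₁⟩ ⟨⟨φ₂, h₂⟩, l₂, hl₂⟩ h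
    have e₁ := hΦ (⟨φ₁, h₁⟩, ⟨l₁, hl₁⟩)
    have e₂ := hΦ (⟨φ₂, h₂⟩, ⟨l₂, hl₂⟩)
    rw [h] at e₁
    obtain ⟨f₁, hf₁, rfl⟩ := h₁
    obtain ⟨f₂, hf₂, rfl⟩ := h₂
    obtain ⟨hf, hl⟩ := e₁.eq_of_eq hf₁ hf₂ hl₁ hl₂ e₂
    simp [hf, hl]
  · rintro ⟨ψ, hψ⟩
    obtain ⟨f, lam, hf, hlam, h⟩ := ChouikhaIsochronous.exists_isAnalyticSolutionGerm hψ
    exact ⟨(⟨_, f, hf, rfl⟩, ⟨lam, hlam⟩), Subtype.ext (huniq (⟨_, f, hf, rfl⟩, ⟨lam, hlam⟩) ψ h).symm⟩
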